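/- Let $E$ be a finite-dimensional real Euclidean space with scalar product $\langle\cdot,\cdot\rangle$, and let $R\subset E$ be an irreducible, reduced, crystallographic root system spanning $E$. Put $\alpha^\vee=2\alpha/\langle\alpha,\alpha\rangle$ for $\alpha\in R$, let $W$ be the Weyl group generated by the reflections $x\mapsto x-\langle x,\alpha^\vee\rangle\alpha$ $(\alpha\in R)$, and fix a system of positive roots $R_+$. Let $R_+^{(s)}$ and $R_+^{(l)}$ be the sets of short and of long roots in $R_+$; if all roots have the same length, all of them are called short and $R_+^{(l)}=\emptyset$. Let $$\mathcal P_+=\{\lambda\in E\mid \langle\lambda,\alpha^\vee\rangle\in\mathbb Z\ \ \forall\alpha\in R,\ \ \langle\lambda,\alpha^\vee\rangle\in\mathbb Z_{\ge 0}\ \ \forall\alpha\in R_+\}$$ be the set of dominant weights, and for $\lambda\in\mathcal P_+$ put $$m^{(s)}(\lambda)=\min_{\alpha\in R_+^{(s)}}\langle\lambda,\alpha^\vee\rangle,\qquad m^{(l)}(\lambda)=\min_{\alpha\in R_+^{(l)}}\langle\lambda,\alpha^\vee\rangle ,$$ where everything concerning $m^{(l)}$ is void if $R_+^{(l)}=\emptyset$.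 Proposition. Let $\lambda\in\mathcal P_+$ and let $n_\alpha$, $\alpha\in R_+$, be integers such that $0\le n_\alpha\le m^{(s)}(\lambda)$ for all $\alpha\in R_+^{(s)}$ and $0\le n_\alpha\le m^{(l)}(\lambda)$ for all $\alpha\in R_+^{(l)}$. If $$\lambda-\sum_{\alpha\in R_+}n_\alpha\,\alpha\in W(\lambda),$$ then $n_\alpha\in\{0,m^{(s)}(\lambda)\}$ for all $\alpha\in R_+^{(s)}$ and $n_\alpha\in\{0,m^{(l)}(\lambda)\}$ for all $\alpha\in R_+^{(l)}$. -/

import Mathlib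

namespace EuclideanRoots

variable {ι E : Type*} [NormedAddCommGroup E] [InnerProductSpace ℝ E]

/-- The root pairing `P` lives inside the Euclidean space `E`: roots and coroots are vectors of `E`,
paired by the scalar product of `E`, and the coroot of a root `α` is `α^∨ = 2 α / ⟪α, α⟫`.
In particular `P.reflection i` is the orthogonal reflection in the hyperplane perpendicular to
the root `P.root i`. -/
structure IsEuclidean (P : RootPairing ι ℝ E E) : Prop where
  toLinearMap_eq : P.toLinearMap = innerₗ E
  coroot_eq : ∀ i, P.coroot i = (2 / inner ℝ (P.root i) (P.root i)) • P.root i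

/-- A root is long if some root is strictly shorter (so there are no long roots if all roots have
the same length). -/
def IsLong (P : RootPairing ι ℝ E E) (i : ι) : Prop :=
  ∃ j, ‖P.root j‖ < ‖P.root i‖

/-- A root is short if it has minimal length (so all roots are short if all roots have
the same length). -/
def IsShort (P : RootPairing ι ℝ E E) (i : ι) : Prop :=
  ∀ j, ‖P.root i‖ ≤ ‖P.root j‖

/-- The weight lattice: `⟪x, α^∨⟫ ∈ ℤ` for all roots `α`. -/
def weightLattice (P : RootPairing ι ℝ E E) : Set E :=
  {x | ∀ i, ∃ k : ℤ, inner ℝ x (P.coroot i) = (k : ℝ)}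

/-- The dominant weights: weights with `⟪x, α^∨⟫ ∈ ℕ` for all positive roots `α`. -/
def dominantWeights {P : RootPairing ι ℝ E E} (b : P.Base) : Set E :=
  {x | x ∈ weightLattice P ∧ ∀ i, b.IsPos i → ∃ k : ℕ, inner ℝ x (P.coroot i) = (k : ℝ)}

/-- The minimum of `⟪x, α^∨⟫` over the positive short roots `α` (a nonempty finite set as soon as
there is a root). -/
noncomputable def mShort {P : RootPairing ι ℝ E E} (b : P.Base) (x : E) : ℝ :=
  sInf ((fun i => inner ℝ x (P.coroot i)) '' {i | b.IsPos i ∧ IsShort P i})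

/-- The minimum of `⟪x, α^∨⟫` over the positive long roots `α` (a finite set; its value is
irrelevant if there are no long roots). -/
noncomputable def mLong {P : RootPairing ι ℝ E E} (b : P.Base) (x : E) : ℝ :=
  sInf ((fun i => inner ℝ x (P.coroot i)) '' {i | b.IsPos i ∧ IsLong P i})

open Classical in
/-- The (finite) set of indices of positive roots. -/
noncomputable def posRoots [Fintype ι] {P : RootPairing ι ℝ E E} (b : P.Base) : Finset ι :=
  Finset.univ.filter fun i => b.IsPos i

end EuclideanRoots

namespace EuclideanRoots

section

variable {ι E : Type*} [NormedAddCommGroup E] [InnerProductSpace ℝ E] {P : RootPairing ι ℝ E E}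

/-! Let `c` be the Weyl-invariant function equal to the relevant minimum on each length class, `s =
∑ c α` and `r = ∑ α` over positive roots, and `w • x = x - ∑ n α`. Then `μ = 2x - s` is dominant, so
`⟪μ - w • μ, w • r⟫ = -⟪μ, r - w • r⟫ ≤ 0`. But `μ - w • μ` equals `∑ 2 n α` minus the sum of `2 c
α` over the positive `α` made negative by `w⁻¹`. As `0 ≤ n ≤ c`, each term pairs nonnegatively with
`w • r`, so each pairing vanishes; regularity of `r` then forces `n = 0` or `n = c`. -/

/-- In a Euclidean root pairing, the scalar product is an invariant form. -/
noncomputable def IsEuclidean.invariantForm (hP : IsEuclidean P) : P.InvariantForm where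
  form := innerₗ E
  symm := ⟨fun x y => by simp [real_inner_comm]⟩
  ne_zero i := by simpa using P.ne_zero i
  isOrthogonal_reflection i x y := by
    have h0 : inner ℝ (P.root i) (P.root i) ≠ (0 : ℝ) := by simpa using P.ne_zero i
    have key (z : E) : P.toLinearMap z (P.coroot i) =
        2 / inner ℝ (P.root i) (P.root i) * inner ℝ z (P.root i) := by
      rw [hP.toLinearMap_eq, hP.coroot_eq, innerₗ_apply_apply, inner_smul_right]
    simp only [RootPairing.reflection_apply, innerₗ_apply_apply, inner_sub_left, inner_sub_right,
      inner_smul_left, inner_smul_right, RootPairing.coroot', LinearMap.flip_apply,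
      key, conj_trivial, real_inner_comm (P.root i)]
    field_simp
    ring

lemma IsEuclidean.inner_smul_smul (hP : IsEuclidean P) (w : P.weylGroup) (x y : E) :
    inner ℝ (w • x) (w • y) = (inner ℝ x y : ℝ) :=
  RootPairing.InvariantForm.apply_weylGroup_smul P (B := hP.invariantForm) w x y

lemma IsEuclidean.norm_root_perm (hP : IsEuclidean P) (w : P.weylGroup) (i : ι) :
    ‖P.root (P.weylGroupToPerm w i)‖ = ‖P.root i‖ := by
  rw [← P.weylGroup_apply_root, @norm_eq_sqrt_real_inner E, hP.inner_smul_smul,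
    ← norm_eq_sqrt_real_inner]

lemma IsEuclidean.inner_coroot (hP : IsEuclidean P) (x : E) (i : ι) :
    inner ℝ x (P.coroot i) = 2 / inner ℝ (P.root i) (P.root i) * (inner ℝ x (P.root i) : ℝ) := by
  rw [hP.coroot_eq, inner_smul_right]

lemma IsEuclidean.inner_root_self_pos (_hP : IsEuclidean P) (i : ι) :
    (0 : ℝ) < inner ℝ (P.root i) (P.root i) :=
  real_inner_self_pos.2 (P.ne_zero i)

lemma isLong_iff_not_isShort (i : ι) : IsLong P i ↔ ¬ IsShort P i := by
  simp [IsLong, IsShort]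

lemma inner_nonneg_of_isPos {b : P.Base} {x : E}
    (hx : ∀ i ∈ b.support, (0 : ℝ) ≤ inner ℝ x (P.root i)) [Finite ι] [P.IsCrystallographic]
    {i : ι} (hi : b.IsPos i) : (0 : ℝ) ≤ inner ℝ x (P.root i) := by
  refine hi.induction_on_add hx fun i j k hk hi hj => ?_
  rw [hk, inner_add_right]
  exact add_nonneg hi (hx j hj)

lemma inner_pos_of_isPos {b : P.Base} {x : E}
    (hx : ∀ i ∈ b.support, (0 : ℝ) < inner ℝ x (P.root i)) [Finite ι] [P.IsCrystallographic]
    {i : ι} (hi : b.IsPos i) : (0 : ℝ) < inner ℝ x (P.root i) := by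
  refine hi.induction_on_add hx fun i j k hk hi hj => ?_
  rw [hk, inner_add_right]
  exact add_pos hi (hx j hj)

lemma isPos_reflectionPerm_self (b : P.Base) (i : ι) :
    b.IsPos (P.reflectionPerm i i) ↔ ¬ b.IsPos i :=
  RootPairing.Base.IsPos.neg_iff_not b i

lemma weylGroupToPerm_ofIdx (i : ι) :
    P.weylGroupToPerm (RootPairing.weylGroup.ofIdx P i) = P.reflectionPerm i := by
  ext j
  simp [RootPairing.weylGroup.ofIdx]

lemma weylGroupToPerm_reflectionPerm_self (w : P.weylGroup) (i : ι) :
    P.weylGroupToPerm w (P.reflectionPerm i i) =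
      P.reflectionPerm (P.weylGroupToPerm w i) (P.weylGroupToPerm w i) := by
  apply P.root.injective
  rw [← P.weylGroup_apply_root, RootPairing.root_reflectionPerm, RootPairing.root_reflectionPerm,
    RootPairing.reflection_apply_self, RootPairing.reflection_apply_self, smul_neg,
    P.weylGroup_apply_root]

/-! ### Weighted sums of positive roots under the Weyl group -/

open Classical in
/-- The sign of a root with respect to a base: `1` for positive and `-1` for negative roots. -/
noncomputable def rootSign (b : P.Base) (i : ι) : ℝ := if b.IsPos i then 1 else -1

lemma rootSign_of_isPos {b : P.Base} {i : ι} (hi : b.IsPos i) : rootSign b i = 1 := if_pos hi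

lemma rootSign_of_not_isPos {b : P.Base} {i : ι} (hi : ¬ b.IsPos i) : rootSign b i = -1 :=
  if_neg hi

lemma rootSign_reflectionPerm_self (b : P.Base) (i : ι) :
    rootSign b (P.reflectionPerm i i) = - rootSign b i := by
  by_cases hi : b.IsPos i <;> simp [rootSign, isPos_reflectionPerm_self, hi]

section

variable [Fintype ι]

lemma mem_posRoots {b : P.Base} {i : ι} : i ∈ posRoots b ↔ b.IsPos i := by
  simp [posRoots]

/-- The sum of the positive roots with weights `c`. -/
noncomputable def posSum (b : P.Base) (c : ι → ℝ) : E := ∑ i ∈ posRoots b, c i • P.root i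

/-- The sum over all roots of a function invariant under negation is twice its sum over the
positive roots. -/
lemma sum_eq_two_smul_sum_posRoots (b : P.Base) (f : ι → E)
    (hf : ∀ i, f (P.reflectionPerm i i) = f i) :
    ∑ i, f i = (2 : ℝ) • ∑ i ∈ posRoots b, f i := by
  classical
  rw [two_smul, ← Finset.sum_filter_add_sum_filter_not Finset.univ (fun i => b.IsPos i)]
  have h1 : Finset.univ.filter (fun i => b.IsPos i) = posRoots b := by ext; simp [posRoots]
  rw [h1]
  congr 1
  have hneg (i : ι) : P.reflectionPerm (P.reflectionPerm i i) (P.reflectionPerm i i) = i :=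
    P.indexNeg.neg_neg i
  refine Finset.sum_bij' (fun i _ => P.reflectionPerm i i) (fun i _ => P.reflectionPerm i i)
    ?_ ?_ ?_ ?_ ?_
  · intro i hi
    rw [mem_posRoots, isPos_reflectionPerm_self]
    simpa using hi
  · intro i hi
    rw [mem_posRoots] at hi
    simpa [isPos_reflectionPerm_self] using hi
  · intro i _
    exact hneg i
  · intro i _
    exact hneg i
  · intro i _
    exact (hf i).symm

lemma two_smul_posSum (b : P.Base)
    {c : ι → ℝ} (hc : ∀ (w : P.weylGroup) i, c (P.weylGroupToPerm w i) = c i) :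
    (2 : ℝ) • posSum b c = ∑ i, (rootSign b i * c i) • P.root i := by
  rw [sum_eq_two_smul_sum_posRoots b, posSum]
  · congr 1
    refine Finset.sum_congr rfl fun i hi => ?_
    rw [rootSign_of_isPos (mem_posRoots.1 hi), one_mul]
  · intro i
    have := hc (RootPairing.weylGroup.ofIdx P i) i
    rw [weylGroupToPerm_ofIdx] at this
    rw [rootSign_reflectionPerm_self, this]
    simp

/-- Twice the weighted sum is a signed sum over all roots, which `w` merely permutes; only the signs
change. -/
lemma smul_posSum (b : P.Base)
    {c : ι → ℝ} (hc : ∀ (w : P.weylGroup) i, c (P.weylGroupToPerm w i) = c i)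
    (w : P.weylGroup) :
    w • posSum b c = ∑ i ∈ posRoots b, (rootSign b (P.weylGroupToPerm w⁻¹ i) * c i) • P.root i := by
  have h2 : (2 : ℝ) ≠ 0 := two_ne_zero
  apply smul_right_injective E h2
  simp only
  rw [← sum_eq_two_smul_sum_posRoots b
      (fun i => (rootSign b (P.weylGroupToPerm w⁻¹ i) * c i) • P.root i),
    ← smul_comm w, two_smul_posSum b hc, Finset.smul_sum,
    ← Equiv.sum_comp (P.weylGroupToPerm w)
      (fun i => (rootSign b (P.weylGroupToPerm w⁻¹ i) * c i) • P.root i)]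
  · refine Finset.sum_congr rfl fun i _ => ?_
    rw [smul_comm, P.weylGroup_apply_root, hc, ← Equiv.Perm.mul_apply, ← map_mul]
    simp
  · intro i
    have := hc (RootPairing.weylGroup.ofIdx P i) i
    rw [weylGroupToPerm_ofIdx] at this
    rw [weylGroupToPerm_reflectionPerm_self, rootSign_reflectionPerm_self, this]
    simp

/-- The coefficient is `2 * c i` on the positive roots that `w⁻¹` makes negative, and `0` on the
others. -/
lemma posSum_sub_smul_posSum (b : P.Base)
    {c : ι → ℝ} (hc : ∀ (w : P.weylGroup) i, c (P.weylGroupToPerm w i) = c i)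
    (w : P.weylGroup) :
    posSum b c - w • posSum b c =
      ∑ i ∈ posRoots b, ((1 - rootSign b (P.weylGroupToPerm w⁻¹ i)) * c i) • P.root i := by
  rw [smul_posSum b hc, posSum, ← Finset.sum_sub_distrib]
  refine Finset.sum_congr rfl fun i _ => ?_
  module

/-- A simple reflection makes only its own positive root negative, so it lowers the weighted sum by
`2 * c i` times that root. -/
lemma IsEuclidean.inner_posSum_of_mem_support [P.IsCrystallographic] [P.IsReduced]
    (hP : IsEuclidean P) (b : P.Base)
    {c : ι → ℝ} (hc : ∀ (w : P.weylGroup) i, c (P.weylGroupToPerm w i) = c i)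
    {i : ι} (hi : i ∈ b.support) :
    inner ℝ (posSum b c) (P.root i) = c i * (inner ℝ (P.root i) (P.root i) : ℝ) := by
  have hinv : (RootPairing.weylGroup.ofIdx P i)⁻¹ = RootPairing.weylGroup.ofIdx P i := by
    ext1
    simp [RootPairing.weylGroup.ofIdx]
  have h := posSum_sub_smul_posSum b hc (RootPairing.weylGroup.ofIdx P i)
  rw [hinv, weylGroupToPerm_ofIdx, Finset.sum_eq_single i] at h
  · rw [rootSign_reflectionPerm_self,
      rootSign_of_isPos (RootPairing.Base.isPos_of_mem_support hi)] at h
    have hr : RootPairing.weylGroup.ofIdx P i • P.root i = - P.root i := by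
      rw [P.weylGroup_apply_root, weylGroupToPerm_ofIdx]
      simp
    have h1 := hP.inner_smul_smul (RootPairing.weylGroup.ofIdx P i) (posSum b c) (P.root i)
    rw [hr, inner_neg_right] at h1
    have h2 := congrArg (fun x : E => (inner ℝ x (P.root i) : ℝ)) h
    simp only [inner_sub_left, inner_smul_left, conj_trivial] at h2
    linarith
  · intro j hj hji
    rw [rootSign_of_isPos ((mem_posRoots.1 hj).reflectionPerm hi hji)]
    simp
  · intro hn
    exact absurd (mem_posRoots.2 (RootPairing.Base.isPos_of_mem_support hi)) hn

/-! ### The extremality argument -/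

/-- Let `c` be invariant under the Weyl group, and suppose that `c i ≤ ⟪x, α^∨⟫` for all simple
roots. If `x` minus a combination of positive roots with coefficients `0 ≤ n i ≤ c i` is in the
Weyl group orbit of `x`, then all the coefficients are extremal. -/
theorem IsEuclidean.eq_zero_or_eq_of_sub_sum_mem_orbit [P.IsCrystallographic] [P.IsReduced]
    (hP : IsEuclidean P) (b : P.Base)
    {c : ι → ℝ} (hc : ∀ (w : P.weylGroup) i, c (P.weylGroupToPerm w i) = c i)
    {x : E} (hx : ∀ i ∈ b.support, c i ≤ inner ℝ x (P.coroot i))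
    {n : ι → ℝ} (hn : ∀ i, b.IsPos i → 0 ≤ n i ∧ n i ≤ c i)
    (horbit : x - ∑ i ∈ posRoots b, n i • P.root i ∈ MulAction.orbit P.weylGroup x)
    {i : ι} (hi : b.IsPos i) : n i = 0 ∨ n i = c i := by
  obtain ⟨w, hw⟩ := horbit
  simp only at hw
  have h1 : ∀ (w : P.weylGroup) (i : ι), (fun _ : ι => (1 : ℝ)) (P.weylGroupToPerm w i) =
      (fun _ => (1 : ℝ)) i := fun _ _ => rfl
  set r : E := posSum b fun _ => 1 with hr
  have hrpos {i : ι} (hi : b.IsPos i) : (0 : ℝ) < inner ℝ r (P.root i) :=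
    inner_pos_of_isPos (fun i hi => by
      rw [hr, hP.inner_posSum_of_mem_support b h1 hi, one_mul]
      exact hP.inner_root_self_pos i) hi
  -- Since `r` is regular dominant, the sign of `⟪α, w • r⟫` detects whether `w⁻¹ α` is positive.
  have hy (i : ι) : (inner ℝ (P.root i) (w • r) : ℝ) =
      inner ℝ r (P.root (P.weylGroupToPerm w⁻¹ i)) := by
    rw [← hP.inner_smul_smul w⁻¹, inv_smul_smul, P.weylGroup_apply_root, real_inner_comm]
  have hypos {i : ι} (hi : b.IsPos (P.weylGroupToPerm w⁻¹ i)) :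
      (0 : ℝ) < inner ℝ (P.root i) (w • r) := by
    rw [hy]
    exact hrpos hi
  have hyneg {i : ι} (hi : ¬ b.IsPos (P.weylGroupToPerm w⁻¹ i)) :
      (inner ℝ (P.root i) (w • r) : ℝ) < 0 := by
    have := hrpos ((isPos_reflectionPerm_self b _).2 hi)
    rw [RootPairing.root_reflectionPerm, RootPairing.reflection_apply_self, inner_neg_right] at this
    rw [hy]
    linarith
  set s := posSum b c with hs
  have hμ {i : ι} (hi : b.IsPos i) : (0 : ℝ) ≤ inner ℝ ((2 : ℝ) • x - s) (P.root i) := by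
    refine inner_nonneg_of_isPos (fun i hi => ?_) hi
    rw [inner_sub_left, inner_smul_left, hs, hP.inner_posSum_of_mem_support b hc hi]
    have h := hx i hi
    rw [hP.inner_coroot] at h
    have h0 := hP.inner_root_self_pos i
    rw [div_mul_eq_mul_div, le_div_iff₀ h0] at h
    simpa using h
  have hle : (inner ℝ (((2 : ℝ) • x - s) - w • ((2 : ℝ) • x - s)) (w • r) : ℝ) ≤ 0 := by
    rw [inner_sub_left, hP.inner_smul_smul, ← inner_sub_right, ← neg_sub r, inner_neg_right,
      hr, posSum_sub_smul_posSum b h1, inner_sum, neg_nonpos]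
    refine Finset.sum_nonneg fun i hi => ?_
    rw [inner_smul_right]
    refine mul_nonneg ?_ (hμ (mem_posRoots.1 hi))
    by_cases h : b.IsPos (P.weylGroupToPerm w⁻¹ i)
    · rw [rootSign_of_isPos h]
      norm_num
    · rw [rootSign_of_not_isPos h]
      norm_num
  have hdiff : ((2 : ℝ) • x - s) - w • ((2 : ℝ) • x - s) =
      (2 : ℝ) • (∑ i ∈ posRoots b, n i • P.root i) - (s - w • s) := by
    rw [smul_sub, smul_comm w, hw]
    generalize w • s = t
    module
  rw [hdiff, hs, posSum_sub_smul_posSum b hc, inner_sub_left, inner_smul_left, sum_inner,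
    sum_inner, Finset.mul_sum, sub_nonpos] at hle
  simp only [inner_smul_left, conj_trivial] at hle
  -- The difference of the two sides is `2 n ⟪α, w • r⟫` or `2 (n - c) ⟪α, w • r⟫`, according to the
  -- sign of `w⁻¹ α`. Summed, this reverses `hle`, so every term is an equality.
  have hterm : ∀ i ∈ posRoots b,
      (1 - rootSign b (P.weylGroupToPerm w⁻¹ i)) * c i * inner ℝ (P.root i) (w • r) ≤
        2 * (n i * (inner ℝ (P.root i) (w • r) : ℝ)) := by
    intro i hi
    obtain ⟨h0, h1⟩ := hn i (mem_posRoots.1 hi)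
    by_cases h : b.IsPos (P.weylGroupToPerm w⁻¹ i)
    · have := mul_nonneg h0 (hypos h).le
      rw [rootSign_of_isPos h]
      linarith
    · have := mul_le_mul_of_nonpos_right h1 (hyneg h).le
      rw [rootSign_of_not_isPos h]
      linarith
  have heq := (Finset.sum_eq_sum_iff_of_le hterm).1 (le_antisymm (Finset.sum_le_sum hterm) hle) i
    (mem_posRoots.2 hi)
  by_cases h : b.IsPos (P.weylGroupToPerm w⁻¹ i)
  · left
    rw [rootSign_of_isPos h] at heq
    have : n i * (inner ℝ (P.root i) (w • r) : ℝ) = 0 := by linarith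
    exact (mul_eq_zero.1 this).resolve_right (hypos h).ne'
  · right
    rw [rootSign_of_not_isPos h] at heq
    refine mul_right_cancel₀ (hyneg h).ne ?_
    linarith

end

end

end EuclideanRoots

theorem proposition5p5 {ι E : Type*} [Fintype ι] [NormedAddCommGroup E] [InnerProductSpace ℝ E]
    [FiniteDimensional ℝ E]
    (P : RootPairing ι ℝ E E) [P.IsRootSystem] [P.IsCrystallographic] [P.IsReduced]
    [P.IsIrreducible] (hP : EuclideanRoots.IsEuclidean P) (b : P.Base)
    (lam : E) (hlam : lam ∈ EuclideanRoots.dominantWeights b)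
    (n : ι → ℤ)
    (hshort : ∀ i, b.IsPos i → EuclideanRoots.IsShort P i →
      0 ≤ n i ∧ (n i : ℝ) ≤ EuclideanRoots.mShort b lam)
    (hlong : ∀ i, b.IsPos i → EuclideanRoots.IsLong P i →
      0 ≤ n i ∧ (n i : ℝ) ≤ EuclideanRoots.mLong b lam)
    (horbit : lam - ∑ i ∈ EuclideanRoots.posRoots b, n i • P.root i ∈
      MulAction.orbit P.weylGroup lam) :
    (∀ i, b.IsPos i → EuclideanRoots.IsShort P i →
      n i = 0 ∨ (n i : ℝ) = EuclideanRoots.mShort b lam) ∧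
    (∀ i, b.IsPos i → EuclideanRoots.IsLong P i →
      n i = 0 ∨ (n i : ℝ) = EuclideanRoots.mLong b lam) := by
  have hdec (i : ι) : EuclideanRoots.IsLong P i ↔ ¬ EuclideanRoots.IsShort P i :=
    EuclideanRoots.isLong_iff_not_isShort i
  classical
  have key {i : ι} (hi : b.IsPos i) := hP.eq_zero_or_eq_of_sub_sum_mem_orbit b
    -- This `c` is Weyl-invariant because the Weyl group preserves root lengths.
    (c := fun i => if EuclideanRoots.IsShort P i then EuclideanRoots.mShort b lam
      else EuclideanRoots.mLong b lam) (x := lam) (n := fun i => (n i : ℝ)) (i := i)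
    (fun w i => by
      have h : EuclideanRoots.IsShort P (P.weylGroupToPerm w i) ↔ EuclideanRoots.IsShort P i := by
        simp only [EuclideanRoots.IsShort, hP.norm_root_perm]
      simp only [h])
    (fun i hi => by
      have hpos := RootPairing.Base.isPos_of_mem_support hi
      split_ifs with h
      · exact csInf_le (Set.toFinite _).bddBelow ⟨i, ⟨hpos, h⟩, rfl⟩
      · exact csInf_le (Set.toFinite _).bddBelow ⟨i, ⟨hpos, (hdec i).2 h⟩, rfl⟩)
    (fun i hi => by
      split_ifs with h
      · simpa using hshort i hi h
      · simpa using hlong i hi ((hdec i).2 h))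
    (by simpa only [Int.cast_smul_eq_zsmul] using horbit) hi
  refine ⟨fun i hi h => ?_, fun i hi h => ?_⟩
  · simpa [h] using key hi
  · simpa [(hdec i).1 h] using key hi
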